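/- Conventions. A branching process (BP) is a tuple $\mathcal{B}=(\Gamma,\hookrightarrow,\mathit{Prob},X_0)$ with a finite set $\Gamma$ of types, a finite set ${\hookrightarrow}\subseteq\Gamma\times\Gamma^+$ of rules, a function $\mathit{Prob}$ giving each rule a positive rational probability such that for every $X\in\Gamma$ the probabilities of the rules $X\hookrightarrow w$ sum to $1$, and a start type $X_0\in\Gamma$. We write $X\overset{p}{\hookrightarrow}w$ if $X\hookrightarrow w$ is a rule of probability $p$; $Y$ is a successor of $X$ if there is a rule $X\hookrightarrow uYv$; and $\mathcal{B}[X]$ is $\mathcal{B}$ with start type $X$. A $\mathcal{B}$-tree is an ordered $\Gamma$-labelled tree whose root has type $X_0$ and in which the ordered children of each node of type $X$ have types $X_1,\dots,X_k$ for some rule $X\hookrightarrow X_1\cdots X_k$. Probabilities of sets of $\mathcal{B}$-trees refer to (the completion of) the probability measure under which the set of trees with a given finite prefix has as measure the product of the probabilities of the rules used at the non-leaf nodes of that prefix. A branch is an infinite path starting at the root; a Büchi automaton accepts it if it accepts its sequence of types, starting with the type of the root. Let $\mathcal{B}=(\Gamma,\hookrightarrow,\mathit{Prob},X_0)$ be a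 BP and $\mathcal{A}=(Q,\Gamma,\delta,Q_0,F)$ a nondeterministic Büchi automaton with finite state set $Q$. Let $\mathcal{A}\times\mathcal{B}$ be the Büchi automaton with states $Q\times\Gamma$, initial states $Q_0\times\{X_0\}$, accepting states $F\times\Gamma$ and transitions $\delta_{\mathcal{A}\times\mathcal{B}}((q_1,X_1),X_2)=\delta(q_1,X_1)\times\{X_2\}$ if $X_2$ is a successor of $X_1$, and $\emptyset$ otherwise. Let $(f,X_f)\in F\times\Gamma$ lie on a cycle of the transition graph of $\mathcal{A}\times\mathcal{B}$, and let $Q[f,X_f]$ be the set of states in the strongly connected component of $(f,X_f)$ in this graph. Let $\mathcal{A}[f,X_f]$ be the Büchi automaton with states $\{\bar q_0\}\cup Q[f,X_f]$ (with $\bar q_0$ fresh), only initial state $\bar q_0$, only accepting state $(f,X_f)$, and transitions $\delta[f,X_f]((q,X),Y)=\delta_{\mathcal{A}\times\mathcal{B}}((q,X),Y)\cap Q[f,X_f]$, $\delta[f,X_f](\bar q_0,X_f)=\{(f,X_f)\}$ and $\delta[f,X_f](\bar q_0,X)=\emptyset$ for $X\ne X_f$. Let $\mathcal{A}_{\mathit{det}}$,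 with transition function $\delta_{\mathit{det}}$, be the determinization of $\mathcal{A}[f,X_f]$ by the subset construction, and let $\Gamma'$ be the set of its states that are reachable from $\{\bar q_0\}$ via a nonempty path; each of them has the form $P\times\{X\}$ with $P\subseteq Q$ and $X\in\Gamma$. Let $\mathcal{B}_{\mathit{det}}$ be the BP with types $\Gamma'$, start type $\{(f,X_f)\}$ and rules $$X'\overset{p}{\hookrightarrow}\delta_{\mathit{det}}(X',X_1)\cdots\delta_{\mathit{det}}(X',X_k)$$ for all $X'=P\times\{X\}\in\Gamma'$ with $P\neq\emptyset$ and all $X\overset{p}{\hookrightarrow}X_1\cdots X_k$ (the probabilities of coinciding rules being added), together with $\emptyset\overset{1}{\hookrightarrow}\emptyset$ if $\emptyset\in\Gamma'$. Lemma. The following statements are equivalent: (i) The probability that some branch of a $\mathcal{B}[X_f]$-tree is accepted by $\mathcal{A}[f,X_f]$ is positive. (ii) The probability that some branch of a $\mathcal{B}_{\mathit{det}}$-tree does not have any nodes of type $\emptyset$ is positive. -/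

import Mathlib

open MeasureTheory Filter

/-- A (multi-type) branching process with types `Γ`. For each type `X` the finitely supported
function `prob X` gives the probabilities of the transition rules `X ↪ w`; the rules of `X` are
exactly the words in the support of `prob X`. There are no `ε`-rules. -/
structure BP (Γ : Type*) where
  prob : Γ → List Γ →₀ ℚ
  prob_nonneg : ∀ X w, 0 ≤ prob X w
  prob_sum : ∀ X, ((prob X).sum fun _ p => p) = 1
  prob_nil : ∀ X, prob X [] = 0
  start : Γ

namespace BP

variable {Γ : Type*} (B : BP Γ)

/-- `X ↪ w` is a transition rule. -/
def IsRule (X : Γ) (w : List Γ) : Prop := B.prob X w ≠ 0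

/-- `Y` is a successor of `X`: there is a rule `X ↪ u Y v`. -/
def IsSuccessor (X Y : Γ) : Prop := ∃ u v : List Γ, B.IsRule X (u ++ Y :: v)

/-- `B[X]`: the branching process `B` with start type `X`. -/
def withStart (X : Γ) : BP Γ := { B with start := X }

/-- The right-hand sides of the rules of the type `X`. -/
def Rule (X : Γ) : Type _ := {w : List Γ // w ∈ (B.prob X).support}

/-- The ordered `Γ`-labelled trees generated by `B` whose root has type `X`. A node is addressed
by the list of child indices on the path from the node up to the root: the root is `[]`, and the
`i`-th child of `v` is `i :: v`. The tree sends an address to the label of the node, or to `none`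
if there is no such node. -/
def Tree (X : Γ) : Type _ :=
  {t : List ℕ → Option Γ // t [] = some X ∧
    (∀ v, t v = none → ∀ i, t (i :: v) = none) ∧
    (∀ v Y, t v = some Y → ∃ w, B.IsRule Y w ∧ ∀ i, t (i :: v) = w[i]?)}

variable {B}

/-- The label of the node `v`, if `v` is a node of `t`. -/
def Tree.label {X : Γ} (t : B.Tree X) (v : List ℕ) : Option Γ := t.1 v

/-- `D` is the set of non-leaf nodes of a finite prefix of `t`. -/
def Tree.IsPrefix {X : Γ} (t : B.Tree X) (D : Finset (List ℕ)) : Prop :=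
  (∀ v ∈ D, t.label v ≠ none) ∧ ∀ v i, i :: v ∈ D → v ∈ D

/-- The cylinder set of the finite prefix of `t` whose non-leaf nodes are `D` (so its nodes are
the root and all children of nodes in `D`). -/
def Tree.cyl {X : Γ} (t : B.Tree X) (D : Finset (List ℕ)) : Set (B.Tree X) :=
  {t' | ∀ v ∈ D, ∀ i, t'.label (i :: v) = t.label (i :: v)}

/-- The `σ`-algebra on trees generated by the cylinder sets of finite prefixes. -/
instance Tree.instMeasurableSpace (X : Γ) : MeasurableSpace (B.Tree X) :=
  MeasurableSpace.generateFrom {S | ∃ (t : B.Tree X) (D : Finset (List ℕ)),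
    t.IsPrefix D ∧ S = t.cyl D}

instance Rule.instMeasurableSpace (X : Γ) : MeasurableSpace (B.Rule X) := ⊤

instance Rule.instDiscrete (X : Γ) : DiscreteMeasurableSpace (B.Rule X) := ⟨fun _ => trivial⟩

instance Rule.instFintype (X : Γ) : Fintype (B.Rule X) :=
  inferInstanceAs (Fintype {w : List Γ // w ∈ (B.prob X).support})

variable (B)

/-- The distribution on the rules of `X`. -/
noncomputable def rulePMF (X : Γ) : PMF (B.Rule X) :=
  PMF.ofFintype (fun w => ENNReal.ofReal ((B.prob X w.1 : ℚ) : ℝ)) (by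
    rw [← ENNReal.ofReal_sum_of_nonneg
      (fun w _ => by exact_mod_cast B.prob_nonneg X w.1), ← Rat.cast_sum]
    have h : ∑ w : B.Rule X, B.prob X w.1 = 1 := by
      rw [← B.prob_sum X, Finsupp.sum]
      exact Finset.sum_coe_sort (B.prob X).support (fun w => B.prob X w)
    rw [h]
    simp)

/-- A choice of a rule for every possible node address and type of that node. -/
abbrev Choice : Type _ := (a : List ℕ × Γ) → B.Rule a.2

/-- All choices are independent, with the rule for type `X` chosen according to `prob X`. -/
noncomputable def choiceMeasure : Measure B.Choice :=
  Measure.infinitePi fun a : List ℕ × Γ => (B.rulePMF a.2).toMeasure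

variable {B}

/-- The labels of the tree that grows from a root of type `X` by the choices `ω`. -/
def growLabel (X : Γ) (ω : B.Choice) : List ℕ → Option Γ
  | [] => some X
  | i :: v =>
    match growLabel X ω v with
    | none => none
    | some Y => (ω (v, Y)).1[i]?

/-- The tree that grows from a root of type `X` by the choices `ω`. -/
def grow (X : Γ) (ω : B.Choice) : B.Tree X :=
  ⟨growLabel X ω, rfl, fun v h i => by simp [growLabel, h], fun v Y h =>
    ⟨(ω (v, Y)).1, Finsupp.mem_support_iff.1 (ω (v, Y)).2, fun i => by simp [growLabel, h]⟩⟩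

variable (B)

/-- The probability measure `P_X` on the trees with root type `X`; it is the law of the tree that grows
by random choices, and `treeMeasure_cyl` below gives its values on cylinder sets. -/
noncomputable def treeMeasure (X : Γ) : Measure (B.Tree X) := B.choiceMeasure.map (grow X)

/-- The probability measure `P_B` on the trees generated from the start type. -/
noncomputable def P : Measure (B.Tree B.start) := B.treeMeasure B.start

variable {B}

theorem grow_mem_cyl_iff {X : Γ} {t : B.Tree X} {D : Finset (List ℕ)} (hD : t.IsPrefix D)
    (T : List ℕ → Γ) (R : List ℕ → List Γ) (hT : ∀ v ∈ D, t.label v = some (T v))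
    (hR : ∀ v ∈ D, ∀ i, t.label (i :: v) = (R v)[i]?) (ω : B.Choice) :
    grow X ω ∈ t.cyl D ↔ ∀ v ∈ D, (ω (v, T v)).1 = R v := by
  have key : ∀ v ∈ D, (growLabel X ω v = t.label v) →
      ∀ i, growLabel X ω (i :: v) = (ω (v, T v)).1[i]? := by
    intro v hv h i
    simp [growLabel, h, hT v hv]
  have lab : t.label [] = some X := t.2.1
  constructor
  · intro h v hv
    have h0 : growLabel X ω v = t.label v := by
      cases v with
      | nil => rw [lab]; rfl
      | cons i u => exact h u (hD.2 u i hv) i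
    refine List.ext_getElem? fun i => ?_
    rw [← key v hv h0 i, ← hR v hv i]
    exact h v hv i
  · intro h
    have h0 : ∀ v ∈ D, growLabel X ω v = t.label v := by
      intro v
      induction v with
      | nil => intro _; rw [lab]; rfl
      | cons i u ih =>
        intro hv
        have hu := hD.2 u i hv
        rw [key u hu (ih hu) i, h u hu, hR u hu i]
    intro v hv i
    change growLabel X ω (i :: v) = _
    rw [key v hv (h0 v hv) i, h v hv, hR v hv i]

theorem Tree.exists_rules {X : Γ} (t : B.Tree X) {D : Finset (List ℕ)} (hD : t.IsPrefix D) :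
    ∃ (T : List ℕ → Γ) (R : List ℕ → List Γ), (∀ v ∈ D, t.label v = some (T v)) ∧
      ∀ v ∈ D, ∀ i, t.label (i :: v) = (R v)[i]? := by
  have : ∀ v, ∃ (Y : Γ) (w : List Γ), v ∈ D → t.label v = some Y ∧
      ∀ i, t.label (i :: v) = w[i]? := by
    intro v
    by_cases hv : v ∈ D
    · obtain ⟨Y, hY⟩ := Option.ne_none_iff_exists'.1 (hD.1 v hv)
      obtain ⟨w, -, hw⟩ := t.2.2.2 v Y hY
      exact ⟨Y, w, fun _ => ⟨hY, hw⟩⟩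
    · exact ⟨X, [], fun h => absurd h hv⟩
  choose T R h using this
  exact ⟨T, R, fun v hv => (h v hv).1, fun v hv => (h v hv).2⟩

theorem measurable_grow (X : Γ) : Measurable (grow X : B.Choice → B.Tree X) := by
  refine measurable_generateFrom ?_
  rintro _ ⟨t, D, hD, rfl⟩
  obtain ⟨T, R, hT, hR⟩ := t.exists_rules hD
  have : grow X ⁻¹' t.cyl D = ⋂ v ∈ D, {ω : B.Choice | (ω (v, T v)).1 = R v} := by
    ext ω
    simp only [Set.mem_preimage, grow_mem_cyl_iff hD T R hT hR, Set.mem_iInter, Set.mem_ofPred_eq]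
  rw [this]
  refine Finset.measurableSet_biInter D fun v _ => ?_
  exact (measurable_pi_apply (X := fun a : List ℕ × Γ => B.Rule a.2) (v, T v))
    (t := {r : B.Rule (T v) | r.1 = R v}) (MeasurableSet.of_discrete)

instance (X : Γ) : IsProbabilityMeasure (B.treeMeasure X) := by
  unfold treeMeasure choiceMeasure
  exact Measure.isProbabilityMeasure_map (measurable_grow X).aemeasurable

/-- The probability of the cylinder set of a finite prefix is the product of the probabilities
of the rules used at its non-leaf nodes. -/
theorem treeMeasure_cyl {X : Γ} {t : B.Tree X} {D : Finset (List ℕ)} (hD : t.IsPrefix D)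
    (T : List ℕ → Γ) (R : List ℕ → List Γ) (hT : ∀ v ∈ D, t.label v = some (T v))
    (hR : ∀ v ∈ D, ∀ i, t.label (i :: v) = (R v)[i]?) :
    B.treeMeasure X (t.cyl D) = ∏ v ∈ D, ENNReal.ofReal ((B.prob (T v) (R v) : ℚ) : ℝ) := by
  classical
  have hmem : ∀ v ∈ D, R v ∈ (B.prob (T v)).support := by
    intro v hv
    obtain ⟨w, hw, hw'⟩ := t.2.2.2 v (T v) (hT v hv)
    have : R v = w := List.ext_getElem? fun i => by rw [← hR v hv i]; exact hw' i
    rw [this]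
    exact Finsupp.mem_support_iff.2 hw
  rw [treeMeasure, Measure.map_apply (measurable_grow X)
    (MeasurableSpace.measurableSet_generateFrom ⟨t, D, hD, rfl⟩)]
  let e : List ℕ → List ℕ × Γ := fun v => (v, T v)
  have he : Set.InjOn e D := fun a _ b _ h => congrArg Prod.fst h
  have hset : grow X ⁻¹' t.cyl D =
      Set.pi (D.image e) (fun a : List ℕ × Γ => {r : B.Rule a.2 | r.1 = R a.1}) := by
    ext ω
    simp only [Set.mem_preimage, grow_mem_cyl_iff hD T R hT hR, Set.mem_pi, Finset.coe_image,
      Set.forall_mem_image, Finset.mem_coe, Set.mem_ofPred_eq, e]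
  rw [hset, choiceMeasure, Measure.infinitePi_pi _ (fun _ _ => MeasurableSet.of_discrete),
    Finset.prod_image he]
  refine Finset.prod_congr rfl fun v hv => ?_
  obtain ⟨r₀, hr₀⟩ : ∃ r₀ : B.Rule (T v), r₀.1 = R v := ⟨⟨R v, hmem v hv⟩, rfl⟩
  have hs : {r : B.Rule (T v) | r.1 = R v} = {r₀} := by
    ext r
    rw [Set.mem_ofPred_eq, Set.mem_singleton_iff, ← hr₀]
    exact ⟨fun h => Subtype.ext h, fun h => h ▸ rfl⟩
  change (B.rulePMF (T v)).toMeasure {r : B.Rule (T v) | r.1 = R v} = _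
  rw [hs, PMF.toMeasure_apply_singleton _ _ (MeasurableSet.of_discrete), ← hr₀]
  rfl

/-- `v 0, v 1, …` is a branch of `t`. -/
def Tree.IsBranch {X : Γ} (t : B.Tree X) (v : ℕ → List ℕ) : Prop :=
  v 0 = [] ∧ ∀ n, t.label (v n) ≠ none ∧ ∃ i, v (n + 1) = i :: v n

end BP

/-- A nondeterministic Büchi automaton has the same data as Mathlib's `NFA`; it accepts the
infinite word `x 0, x 1, …` if there is a run of it that starts in an initial state and visits
accepting states infinitely often. -/
def NFA.BuchiAccepts {Γ Q : Type*} (A : NFA Γ Q) (x : ℕ → Γ) : Prop :=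
  ∃ r : ℕ → Q, r 0 ∈ A.start ∧ (∀ n, r (n + 1) ∈ A.step (r n) (x n)) ∧
    ∃ᶠ n in atTop, r n ∈ A.accept

/-- There is an edge from `p` to `q` in the transition graph of `A`. -/
def NFA.Edge {Γ Q : Type*} (A : NFA Γ Q) (p q : Q) : Prop := ∃ X, q ∈ A.step p X

section SCCAutomaton

variable {Γ Q : Type*} (A : NFA Γ Q) (B : BP Γ)

/-- The product automaton `A × B`. -/
def prodAut : NFA Γ (Q × Γ) where
  step p X := {r | B.IsSuccessor p.2 X ∧ r.1 ∈ A.step p.1 p.2 ∧ r.2 = X}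
  start := A.start ×ˢ {B.start}
  accept := A.accept ×ˢ Set.univ

/-- `Q[f, X_f]`: the states in the strongly connected component of `(f, X_f)` in the transition
graph of `A × B`. -/
abbrev SCCState (f : Q) (Xf : Γ) : Type _ :=
  {p : Q × Γ // Relation.ReflTransGen (prodAut A B).Edge (f, Xf) p ∧
    Relation.ReflTransGen (prodAut A B).Edge p (f, Xf)}

/-- The state `(f, X_f)` of `Q[f, X_f]`. -/
def SCCState.base (f : Q) (Xf : Γ) : SCCState A B f Xf :=
  ⟨(f, Xf), Relation.ReflTransGen.refl, Relation.ReflTransGen.refl⟩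

/-- The automaton `A[f, X_f]`; its fresh initial state is `none`. -/
def sccAut (f : Q) (Xf : Γ) : NFA Γ (Option (SCCState A B f Xf)) where
  step
    | none, X => {s | X = Xf ∧ s = some (SCCState.base A B f Xf)}
    | some p, X => {s | ∃ r : SCCState A B f Xf, s = some r ∧ r.1 ∈ (prodAut A B).step p.1 X}
  start := {none}
  accept := {some (SCCState.base A B f Xf)}

/-- `A_det`: the determinization of `A[f, X_f]` by the subset construction. -/
def detAut (f : Q) (Xf : Γ) : DFA Γ (Set (Option (SCCState A B f Xf))) where
  step := (sccAut A B f Xf).stepSet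
  start := (sccAut A B f Xf).start
  accept := {S | S ≠ ∅}

/-- `Γ'`: the states of `A_det` that are reachable from its initial state by a nonempty path. -/
abbrev DetType (f : Q) (Xf : Γ) : Type _ :=
  {S : Set (Option (SCCState A B f Xf)) // ∃ w : List Γ, w ≠ [] ∧ (detAut A B f Xf).eval w = S}

variable {A B} {f : Q} {Xf : Γ}

/-- `δ_det` on `Γ'`. -/
def DetType.next (S : DetType A B f Xf) (X : Γ) : DetType A B f Xf :=
  ⟨(detAut A B f Xf).step S.1 X, by
    obtain ⟨w, -, hw⟩ := S.2
    exact ⟨w ++ [X], by simp, by rw [DFA.eval_append_singleton, hw]⟩⟩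

/-- The type `{(f, X_f)}`. -/
def DetType.base (A : NFA Γ Q) (B : BP Γ) (f : Q) (Xf : Γ) : DetType A B f Xf :=
  ⟨{some (SCCState.base A B f Xf)}, [Xf], by simp, by
    ext s
    simp [DFA.eval, DFA.evalFrom, detAut, sccAut, NFA.stepSet]⟩

/-- Every element of `Γ'` is of the form `P × {X}` with `P ⊆ Q`. -/
theorem DetType.exists_type (S : DetType A B f Xf) :
    ∃ X : Γ, ∀ s ∈ S.1, ∃ p : SCCState A B f Xf, s = some p ∧ p.1.2 = X := by
  obtain ⟨w, hw, hS⟩ := S.2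
  obtain ⟨u, X, rfl⟩ := (List.eq_nil_or_concat w).resolve_left hw
  refine ⟨X, fun s hs => ?_⟩
  rw [← hS, List.concat_eq_append, DFA.eval_append_singleton] at hs
  obtain ⟨q, -, hq⟩ := NFA.mem_stepSet.1 hs
  cases q with
  | none => exact ⟨_, hq.2, hq.1.symm⟩
  | some p =>
    obtain ⟨r, rfl, hr⟩ := hq
    exact ⟨r, rfl, hr.2.2⟩

/-- A type `X` such that `S` is of the form `P × {X}`; it is unique if `S` is nonempty. -/
noncomputable def DetType.type (S : DetType A B f Xf) : Γ := S.exists_type.choose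

variable (A B f Xf)

open Classical in
/-- The branching process `B_det`. For `S = P × {X}` in `Γ'` with `P ≠ ∅`, each rule
`X ↪ X_1 ⋯ X_k` of `B` contributes its probability to the rule
`S ↪ δ_det(S, X_1) ⋯ δ_det(S, X_k)`, and `∅ ↪ ∅` has probability `1`. -/
noncomputable def detBP : BP (DetType A B f Xf) where
  prob S :=
    if S.1 = ∅ then Finsupp.single [S] 1
    else Finsupp.mapDomain (List.map S.next) (B.prob S.type)
  prob_nonneg S w := by
    split_ifs
    · rw [Finsupp.single_apply]; split_ifs <;> norm_num
    · rw [Finsupp.mapDomain, Finsupp.sum_apply]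
      refine Finset.sum_nonneg fun u _ => ?_
      simp only [Finsupp.single_apply]
      split_ifs
      · exact B.prob_nonneg _ _
      · exact le_rfl
  prob_sum S := by
    split_ifs
    · simp
    · rw [Finsupp.sum_mapDomain_index (fun _ => rfl) (fun _ _ _ => rfl)]
      exact B.prob_sum _
  prob_nil S := by
    split_ifs
    · simp
    · rw [Finsupp.mapDomain, Finsupp.sum_apply]
      refine Finset.sum_eq_zero fun u hu => ?_
      simp only [Finsupp.single_apply]
      refine if_neg fun h => ?_
      rw [List.map_eq_nil_iff] at h
      subst h
      exact Finsupp.mem_support_iff.1 hu (B.prob_nil _)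
  start := DetType.base A B f Xf

end SCCAutomaton

/-! ### Shifted choices and independence of levels -/

namespace BP

variable {Γ : Type*} {B : BP Γ}

/-! Both processes are driven by the same random choices: one rule of `B` for every pair of an
address and a type. From these choices `grow` builds the tree of `B` and `detGrow` a tree of
`detBP`; `map_detGrow` shows that the latter has the right law. Along nonempty labels the second
tree records the state of the subset construction on the first. By König's lemma a branch avoiding
`∅` exists iff nonempty labels occur at all depths, so (ii) says that `survival` from `{(f, X_f)}`
has positive probability.

(i) implies (ii): a run on a branch keeps the subset states along it nonempty.

(ii) implies (i): every nonempty state contains some member of the strongly connected component of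
`(f, X_f)`, and a path of positive probability leads from it back to `(f, X_f)`. From there survival
has positive probability, independently of the past. Hence `recurrence` has positive probability
from each nonempty state (`recurrence_pos`), uniformly because there are finitely many states. A
zero-one argument (`measure_survival_diff_recurrence`) turns this into: survival almost surely
entails recurrence. This holds simultaneously at all nodes, so on survival one returns to `(f, X_f)`
again and again, and the finite runs between the returns concatenate to an accepting run
(`hasBuchiBranch_grow`). -/

instance : IsProbabilityMeasure B.choiceMeasure := by
  unfold choiceMeasure
  infer_instance

/-- The choices seen from the node `v`. -/
def shiftChoice (v : List ℕ) (ω : B.Choice) : B.Choice := fun a => ω (a.1 ++ v, a.2)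

theorem shiftChoice_shiftChoice (u v : List ℕ) (ω : B.Choice) :
    shiftChoice u (shiftChoice v ω) = shiftChoice (u ++ v) ω := by
  funext a
  change ω (a.1 ++ u ++ v, a.2) = ω (a.1 ++ (u ++ v), a.2)
  rw [List.append_assoc]

theorem measurable_shiftChoice (v : List ℕ) :
    Measurable (shiftChoice v : B.Choice → B.Choice) :=
  measurable_pi_lambda _ fun a =>
    measurable_pi_apply (X := fun a : List ℕ × Γ => B.Rule a.2) (a.1 ++ v, a.2)

theorem measurePreserving_shiftChoice (v : List ℕ) :
    MeasurePreserving (shiftChoice v) B.choiceMeasure B.choiceMeasure := by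
  classical
  refine ⟨measurable_shiftChoice v, Measure.eq_infinitePi _ fun s t ht => ?_⟩
  rw [Measure.map_apply (measurable_shiftChoice v)
    (MeasurableSet.pi s.countable_toSet fun a _ => ht a)]
  let e : List ℕ × Γ → List ℕ × Γ := fun a => (a.1 ++ v, a.2)
  have he : Function.Injective e := by
    rintro ⟨a, X⟩ ⟨b, Y⟩ h
    simpa [e] using h
  -- Truncation removes the suffix `v`, so it inverts `e` on its range; the values of `t'` elsewhere
  -- play no role.
  let t' : (a : List ℕ × Γ) → Set (B.Rule a.2) := fun a => t (a.1.take (a.1.length - v.length), a.2)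
  have ht' : ∀ a : List ℕ × Γ, t' (e a) = t a := by
    rintro ⟨a, X⟩
    have : (a ++ v).take ((a ++ v).length - v.length) = a := by simp
    simp only [t', e]
    rw [this]
  have hset : shiftChoice v ⁻¹' (s : Set (List ℕ × Γ)).pi t =
      ((s.image e : Finset _) : Set (List ℕ × Γ)).pi t' := by
    ext ω
    simp only [Set.mem_preimage, Set.mem_pi, Finset.coe_image, Set.forall_mem_image,
      Finset.mem_coe, ht']
    rfl
  rw [hset, choiceMeasure, Measure.infinitePi_pi _ (fun a _ => MeasurableSet.of_discrete),
    Finset.prod_image he.injOn]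
  exact Finset.prod_congr rfl fun a _ => by rw [ht']

variable (B) in
/-- The `σ`-algebra of the choices at the nodes of depth less than `n`. -/
@[reducible] def choicesBelow (n : ℕ) : MeasurableSpace B.Choice :=
  ⨆ a ∈ {a : List ℕ × Γ | a.1.length < n},
    MeasurableSpace.comap (fun ω : B.Choice => ω a) inferInstance

theorem choicesBelow_le (n : ℕ) : choicesBelow B n ≤ MeasurableSpace.pi :=
  iSup₂_le fun a _ => (measurable_pi_apply (X := fun a : List ℕ × Γ => B.Rule a.2) a).comap_le

theorem choicesBelow_mono : Monotone (choicesBelow B) := fun _ _ h =>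
  biSup_mono fun _ ha => lt_of_lt_of_le ha h

theorem measurableSet_choicesBelow {n : ℕ} {a : List ℕ × Γ} (ha : a.1.length < n)
    (s : Set (B.Rule a.2)) : MeasurableSet[choicesBelow B n] {ω : B.Choice | ω a ∈ s} :=
  (le_iSup₂_of_le (f := fun (a : List ℕ × Γ) (_ : a ∈ {a : List ℕ × Γ | a.1.length < n}) =>
    MeasurableSpace.comap (fun ω : B.Choice => ω a) inferInstance) a ha le_rfl) _
    ⟨s, MeasurableSet.of_discrete, rfl⟩

theorem iIndep_choices : ProbabilityTheory.iIndep (fun a : List ℕ × Γ =>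
    MeasurableSpace.comap (fun ω : B.Choice => ω a) inferInstance) B.choiceMeasure := by
  have h : ProbabilityTheory.iIndepFun (fun (a : List ℕ × Γ) (ω : B.Choice) => ω a)
      B.choiceMeasure := by
    have hm : ∀ a : List ℕ × Γ, Measurable fun ω : B.Choice => ω a := fun a =>
      measurable_pi_apply (X := fun a : List ℕ × Γ => B.Rule a.2) a
    rw [ProbabilityTheory.iIndepFun_iff_map_fun_eq_infinitePi_map hm]
    have : ∀ a : List ℕ × Γ, B.choiceMeasure.map (fun ω : B.Choice => ω a) =
        (B.rulePMF a.2).toMeasure := fun a => Measure.infinitePi_map_eval _ a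
    simp only [this]
    exact Measure.map_id
  exact h

/-- What happens above depth `n` is independent of what happens from a node of depth `n` on. -/
theorem choiceMeasure_inter_shift {n : ℕ} {A G : Set B.Choice}
    (hA : MeasurableSet[choicesBelow B n] A) (hG : MeasurableSet G) {v : List ℕ}
    (hv : n ≤ v.length) :
    B.choiceMeasure (A ∩ shiftChoice v ⁻¹' G) = B.choiceMeasure A * B.choiceMeasure G := by
  have hd : Disjoint {a : List ℕ × Γ | a.1.length < n} {a : List ℕ × Γ | n ≤ a.1.length} :=
    Set.disjoint_left.2 fun a (h : _ < n) h' => absurd h (not_lt.2 h')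
  have hi := ProbabilityTheory.indep_iSup_of_disjoint
    (fun a => (measurable_pi_apply (X := fun a : List ℕ × Γ => B.Rule a.2) a).comap_le)
    (iIndep_choices (B := B)) hd
  rw [← (measurePreserving_shiftChoice v).measure_preimage hG.nullMeasurableSet]
  refine (ProbabilityTheory.Indep_iff _ _ _).1 hi A _ hA ?_
  have hm : @Measurable _ _ (⨆ a ∈ {a : List ℕ × Γ | n ≤ a.1.length},
      MeasurableSpace.comap (fun ω : B.Choice => ω a) inferInstance) MeasurableSpace.pi
      (shiftChoice v : B.Choice → B.Choice) := by
    refine @measurable_pi_lambda _ _ _ (_) _ _ fun a => ?_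
    intro s hs
    refine (le_iSup₂_of_le (f := fun (a : List ℕ × Γ) (_ : a ∈ {a : List ℕ × Γ | n ≤ a.1.length}) =>
      MeasurableSpace.comap (fun ω : B.Choice => ω a) inferInstance) (a.1 ++ v, a.2) ?_ le_rfl) _
      ⟨s, hs, rfl⟩
    simp only [Set.mem_ofPred_eq, List.length_append]
    omega
  exact hm hG

/-- Every event can be approximated by events that depend on finitely many levels only. -/
theorem exists_choicesBelow_approx {D : Set B.Choice} (hD : MeasurableSet D) {ε : ℝ}
    (hε : 0 < ε) : ∃ n, ∃ C, MeasurableSet[choicesBelow B n] C ∧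
      B.choiceMeasure.real (symmDiff D C) < ε := by
  -- The level `σ`-algebras increase, so their union is an algebra; it generates the product
  -- `σ`-algebra and is therefore dense in measure.
  let 𝒜 : Set (Set B.Choice) := {C | ∃ n, MeasurableSet[choicesBelow B n] C}
  have halg : IsSetAlgebra 𝒜 :=
    { empty_mem := ⟨0, @MeasurableSet.empty _ (_)⟩
      compl_mem := fun s ⟨n, hn⟩ => ⟨n, hn.compl⟩
      union_mem := fun s t ⟨n, hn⟩ ⟨m, hm⟩ => ⟨max n m,
        (choicesBelow_mono (le_max_left n m) _ hn).union
          (choicesBelow_mono (le_max_right n m) _ hm)⟩ }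
  have hgen : (MeasurableSpace.pi : MeasurableSpace B.Choice) =
      MeasurableSpace.generateFrom 𝒜 := by
    refine le_antisymm (iSup_le fun a => ?_)
      (MeasurableSpace.generateFrom_le fun s ⟨n, hn⟩ => choicesBelow_le n _ hn)
    rintro _ ⟨s, -, rfl⟩
    exact MeasurableSpace.measurableSet_generateFrom
      ⟨a.1.length + 1, measurableSet_choicesBelow (Nat.lt_succ_self _) s⟩
  obtain ⟨C, ⟨n, hn⟩, hC⟩ := (Measure.MeasureDense.of_generateFrom_isSetAlgebra_finite
    (μ := B.choiceMeasure) halg hgen).approx D hD (measure_ne_top _ _) ε hε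
  exact ⟨n, C, hn, (ENNReal.lt_ofReal_iff_toReal_lt (measure_ne_top _ _)).1 hC⟩

end BP

/-! ### Infinite branches, cylinder sets and measurability on trees -/

/-- König's lemma for prefix-closed, finitely branching sets of node addresses. -/
theorem exists_branch_of_forall_level {N : Set (List ℕ)} (hpar : ∀ v i, i :: v ∈ N → v ∈ N)
    (hfin : ∀ v, {i | i :: v ∈ N}.Finite) (hlev : ∀ n, ∃ v ∈ N, v.length = n) :
    ∃ v : ℕ → List ℕ, v 0 = [] ∧ ∀ n, v n ∈ N ∧ ∃ i, v (n + 1) = i :: v n := by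
  have hsuf : ∀ l v : List ℕ, l ++ v ∈ N → v ∈ N := by
    intro l v
    induction l with
    | nil => exact id
    | cons i l ih => exact fun h => ih (hpar _ i h)
  let Deep : List ℕ → Prop := fun v => ∀ n, ∃ u : List ℕ, u.length = n ∧ u ++ v ∈ N
  have step : ∀ v, Deep v → ∃ i, Deep (i :: v) := by
    intro v hv
    by_contra! hc
    -- If no descendant lies at one relative depth, none lies further down either, because `N` is
    -- closed under parents.
    have : ∀ i, ∃ n, ∀ u : List ℕ, n ≤ u.length → u ++ i :: v ∉ N := by
      intro i
      obtain ⟨n, hn⟩ := not_forall.1 (hc i)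
      refine ⟨n, fun u hu hmem => hn ⟨u.drop (u.length - n), by simp; omega, ?_⟩⟩
      refine hsuf (u.take (u.length - n)) _ ?_
      rwa [← List.append_assoc, List.take_append_drop]
    choose m hm using this
    -- A descendant of `v` deeper than the bounds of all its finitely many children; the last entry
    -- of `u` names the child through which it passes.
    obtain ⟨u, hu, hmem⟩ := hv (((hfin v).toFinset.sup m) + 1)
    obtain ⟨u', i, rfl⟩ := (List.eq_nil_or_concat u).resolve_left (by
      rintro rfl
      simp at hu)
    have hmem' : u' ++ i :: v ∈ N := by simpa using hmem
    have hi : i ∈ (hfin v).toFinset := (Set.Finite.mem_toFinset _).2 (hsuf u' _ hmem')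
    refine hm i u' ?_ hmem'
    have := Finset.le_sup (f := m) hi
    simp only [List.concat_eq_append, List.length_append, List.length_singleton] at hu
    omega
  have h0 : Deep [] := fun n => by
    obtain ⟨v, hv, hn⟩ := hlev n
    exact ⟨v, hn, by simpa using hv⟩
  choose c hc using step
  let s : ℕ → {v // Deep v} := fun n => Nat.rec ⟨[], h0⟩ (fun _ p => ⟨_, hc p.1 p.2⟩) n
  refine ⟨fun n => (s n).1, rfl, fun n => ⟨?_, _, rfl⟩⟩
  obtain ⟨u, hu, hmem⟩ := (s n).2 0
  rw [List.length_eq_zero_iff] at hu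
  simpa [hu] using hmem

namespace BP

variable {Γ : Type*} {B : BP Γ} {X : Γ}

theorem Tree.label_append_eq_none (t : B.Tree X) {v : List ℕ} (h : t.label v = none)
    (u : List ℕ) : t.label (u ++ v) = none := by
  induction u with
  | nil => exact h
  | cons i u ih => exact t.2.2.1 _ ih i

theorem Tree.label_eq_of_mem_cyl {t t' : B.Tree X} {D : Finset (List ℕ)} (hD : t.IsPrefix D)
    (h : t' ∈ t.cyl D) {v : List ℕ} (hv : v ∈ D) : t'.label v = t.label v := by
  cases v with
  | nil => exact t'.2.1.trans t.2.1.symm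
  | cons i u => exact h u (hD.2 u i hv) i

theorem Tree.isPrefix_of_mem_cyl {t t' : B.Tree X} {D : Finset (List ℕ)} (hD : t.IsPrefix D)
    (h : t' ∈ t.cyl D) : t'.IsPrefix D :=
  ⟨fun v hv => by rw [label_eq_of_mem_cyl hD h hv]; exact hD.1 v hv, hD.2⟩

theorem Tree.cyl_eq_of_mem {t t' : B.Tree X} {D : Finset (List ℕ)} (h : t' ∈ t.cyl D) :
    t'.cyl D = t.cyl D := by
  ext s
  exact forall₂_congr fun v hv => forall_congr' fun i => by rw [h v hv i]

theorem Tree.isPrefix_tails (t : B.Tree X) {v : List ℕ} (h : t.label v ≠ none) :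
    t.IsPrefix v.tails.toFinset := by
  simp only [IsPrefix, List.mem_toFinset, List.mem_tails]
  refine ⟨?_, fun u i hu => (List.suffix_cons i u).trans hu⟩
  rintro u ⟨w, rfl⟩ hu
  exact h (t.label_append_eq_none hu w)

theorem measurableSet_cyl {t : B.Tree X} {D : Finset (List ℕ)} (hD : t.IsPrefix D) :
    MeasurableSet (t.cyl D) :=
  MeasurableSpace.measurableSet_generateFrom ⟨t, D, hD, rfl⟩

/-- The event splits according to the rules used at the proper ancestors of the node. Each piece is
empty or a cylinder, and there are countably many pieces because `Γ` is countable. -/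
theorem measurableSet_label_eq_some [Countable Γ] (v : List ℕ) (Y : Γ) :
    MeasurableSet {t : B.Tree X | t.label v = some Y} := by
  cases v with
  | nil =>
    have : {t : B.Tree X | t.label [] = some Y} = {_t : B.Tree X | some X = some Y} := by
      ext t
      exact iff_of_eq (congrArg (· = some Y) t.2.1)
    rw [this]
    exact MeasurableSet.const _
  | cons i u =>
    let D := u.tails.toFinset
    let W : ({u // u ∈ D} → List Γ) → Set (B.Tree X) := fun R =>
      {t | t.label (i :: u) = some Y ∧ ∀ w : {u // u ∈ D}, ∀ i, t.label (i :: w.1) = (R w)[i]?}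
    have huD : u ∈ D := by simp [D]
    have hpre : ∀ t : B.Tree X, t.label (i :: u) = some Y → t.IsPrefix D := fun t ht =>
      t.isPrefix_tails fun h => by
        have := t.2.2.1 u h i
        change t.label (i :: u) = none at this
        rw [ht] at this
        cases this
    have hW : ∀ R, MeasurableSet (W R) := by
      intro R
      rcases (W R).eq_empty_or_nonempty with h | ⟨t, ht, htR⟩
      · rw [h]
        exact MeasurableSet.empty
      · have : W R = t.cyl D := by
          ext t'
          refine ⟨fun h v hv j => (h.2 ⟨v, hv⟩ j).trans (htR ⟨v, hv⟩ j).symm, fun h =>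
            ⟨(h u huD i).trans ht, fun w j => (h w.1 w.2 j).trans (htR w j)⟩⟩
        rw [this]
        exact measurableSet_cyl (hpre t ht)
    have : {t : B.Tree X | t.label (i :: u) = some Y} = ⋃ R, W R := by
      ext t
      simp only [Set.mem_ofPred_eq, Set.mem_iUnion]
      refine ⟨fun h => ?_, fun ⟨R, h⟩ => h.1⟩
      obtain ⟨T, R, -, hR⟩ := t.exists_rules (hpre t h)
      exact ⟨fun w => R w.1, h, fun w => hR w.1 w.2⟩
    rw [this]
    exact MeasurableSet.iUnion hW

/-- Cylinders form a `π`-system: if two of them share a tree `t`, their intersection is the cylinder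
of `t` for the union of the two prefixes. -/
theorem Tree.measure_ext {μ ν : Measure (B.Tree X)} [IsFiniteMeasure μ]
    (huniv : μ Set.univ = ν Set.univ)
    (h : ∀ (t : B.Tree X) (D : Finset (List ℕ)), t.IsPrefix D → μ (t.cyl D) = ν (t.cyl D)) :
    μ = ν := by
  classical
  refine ext_of_generate_finite _ rfl ?_ ?_ huniv
  · rintro _ ⟨t₁, D₁, h₁, rfl⟩ _ ⟨t₂, D₂, h₂, rfl⟩ ⟨t, ht₁, ht₂⟩
    have h₁' := isPrefix_of_mem_cyl h₁ ht₁
    have h₂' := isPrefix_of_mem_cyl h₂ ht₂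
    rw [← cyl_eq_of_mem ht₁, ← cyl_eq_of_mem ht₂]
    refine ⟨t, D₁ ∪ D₂, ⟨fun v hv => ?_, fun v i hv => ?_⟩, ?_⟩
    · exact (Finset.mem_union.1 hv).elim (h₁'.1 v) (h₂'.1 v)
    · exact Finset.mem_union.2 ((Finset.mem_union.1 hv).imp (h₁'.2 v i) (h₂'.2 v i))
    · ext s
      simp only [cyl, Set.mem_inter_iff, Set.mem_ofPred_eq, Finset.mem_union, or_imp,
        forall_and]
  · rintro _ ⟨t, D, hD, rfl⟩
    exact h t D hD

end BP

/-! ### Coupling: trees of `detBP` from choices of rules of `B` -/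

section SCCAutomaton

variable {Γ Q : Type*} {A : NFA Γ Q} {B : BP Γ} {f : Q} {Xf : Γ}

open Classical in
/-- The right-hand side of the rule of `detBP` for the type `S` that comes from the right-hand
side `w` of a rule of `B`. -/
noncomputable def detRule (S : DetType A B f Xf) (w : List Γ) : List (DetType A B f Xf) :=
  if S.1 = ∅ then [S] else w.map S.next

theorem detRule_of_ne {S : DetType A B f Xf} (hS : S.1 ≠ ∅) (w : List Γ) :
    detRule S w = w.map S.next := if_neg hS

/-- The rule law of `detBP` is the image under `detRule S` of that of `B`. This also covers `∅`: its
`type` is arbitrary, but all rules are sent to `[S]` and their probabilities add up to 1. -/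
theorem detBP_prob_eq_sum (S R) : (detBP A B f Xf).prob S R =
    ∑ r : B.Rule S.type, ({r | detRule S r.1 = R} : Set (B.Rule S.type)).indicator
      (fun r => B.prob S.type r.1) r := by
  classical
  by_cases hS : S.1 = ∅
  · have h : (detBP A B f Xf).prob S = Finsupp.single [S] 1 := if_pos hS
    have hsum : ∑ r : B.Rule S.type, B.prob S.type r.1 = 1 := by
      rw [← B.prob_sum S.type, Finsupp.sum]
      exact Finset.sum_coe_sort (B.prob S.type).support (fun w => B.prob S.type w)
    simp only [h, detRule, if_pos hS, Set.indicator_apply, Set.mem_ofPred_eq,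
      Finsupp.single_apply]
    split_ifs
    · exact hsum.symm
    · simp
  · have h : (detBP A B f Xf).prob S =
        Finsupp.mapDomain (List.map S.next) (B.prob S.type) := if_neg hS
    simp only [h, detRule, if_neg hS, Set.indicator_apply, Set.mem_ofPred_eq]
    rw [Finsupp.mapDomain, Finsupp.sum_apply, Finsupp.sum]
    simp only [Finsupp.single_apply]
    exact (Finset.sum_coe_sort (B.prob S.type).support
      (fun w => if List.map S.next w = R then B.prob S.type w else 0)).symm

theorem rulePMF_detRule (S : DetType A B f Xf) (R : List (DetType A B f Xf)) :
    (B.rulePMF S.type).toMeasure {r | detRule S r.1 = R} =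
      ENNReal.ofReal (((detBP A B f Xf).prob S R : ℚ) : ℝ) := by
  classical
  rw [PMF.toMeasure_apply_fintype, detBP_prob_eq_sum, Rat.cast_sum,
    ENNReal.ofReal_sum_of_nonneg]
  · refine Finset.sum_congr rfl fun r _ => ?_
    simp only [Set.indicator_apply]
    split_ifs
    · rfl
    · simp
  · intro r _
    simp only [Set.indicator_apply]
    split_ifs
    · exact_mod_cast B.prob_nonneg _ _
    · simp

theorem isRule_detRule (S : DetType A B f Xf) (r : B.Rule S.type) :
    (detBP A B f Xf).IsRule S (detRule S r.1) := by
  classical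
  rw [BP.IsRule, detBP_prob_eq_sum]
  refine ne_of_gt (Finset.sum_pos' (fun r' _ => ?_) ⟨r, Finset.mem_univ r, ?_⟩)
  · simp only [Set.indicator_apply]
    split_ifs
    · exact B.prob_nonneg _ _
    · exact le_rfl
  · rw [Set.indicator_of_mem (by rfl)]
    exact lt_of_le_of_ne (B.prob_nonneg _ _) (Finsupp.mem_support_iff.1 r.2).symm

/-- The labels of the tree of `detBP` with root `S` that belongs to the choices `ω` of rules
of `B`. -/
noncomputable def detLabel (S : DetType A B f Xf) (ω : B.Choice) :
    List ℕ → Option (DetType A B f Xf)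
  | [] => some S
  | i :: v =>
    match detLabel S ω v with
    | none => none
    | some S' => (detRule S' (ω (v, S'.type)).1)[i]?

theorem detLabel_cons {S S' : DetType A B f Xf} {ω : B.Choice} {v : List ℕ}
    (h : detLabel S ω v = some S') (i : ℕ) :
    detLabel S ω (i :: v) = (detRule S' (ω (v, S'.type)).1)[i]? := by
  rw [detLabel, h]

theorem detLabel_cons_eq_some {S T : DetType A B f Xf} {ω : B.Choice} {v : List ℕ} {i : ℕ}
    (h : detLabel S ω (i :: v) = some T) :
    ∃ S', detLabel S ω v = some S' ∧ (detRule S' (ω (v, S'.type)).1)[i]? = some T := by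
  rw [detLabel] at h
  split at h
  · cases h
  · exact ⟨_, by assumption, h⟩

/-- The tree of `detBP` with root `S` that belongs to the choices `ω` of rules of `B`. -/
noncomputable def detGrow (S : DetType A B f Xf) (ω : B.Choice) : (detBP A B f Xf).Tree S :=
  ⟨detLabel S ω, rfl, fun v h i => by rw [detLabel, h], fun v _ h =>
    ⟨_, isRule_detRule _ _, fun i => detLabel_cons h i⟩⟩

theorem detGrow_mem_cyl_iff {S : DetType A B f Xf} {t : (detBP A B f Xf).Tree S}
    {D : Finset (List ℕ)} (hD : t.IsPrefix D)
    (T : List ℕ → DetType A B f Xf) (R : List ℕ → List (DetType A B f Xf))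
    (hT : ∀ v ∈ D, t.label v = some (T v))
    (hR : ∀ v ∈ D, ∀ i, t.label (i :: v) = (R v)[i]?) (ω : B.Choice) :
    detGrow S ω ∈ t.cyl D ↔ ∀ v ∈ D, detRule (T v) (ω (v, (T v).type)).1 = R v := by
  have lab : t.label [] = some S := t.2.1
  constructor
  · intro h v hv
    have h0 : detLabel S ω v = t.label v := by
      cases v with
      | nil => exact lab.symm
      | cons i u => exact h u (hD.2 u i hv) i
    refine List.ext_getElem? fun i => ?_
    rw [← detLabel_cons (h0.trans (hT v hv)) i, ← hR v hv i]
    exact h v hv i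
  · intro h
    have h0 : ∀ v ∈ D, detLabel S ω v = t.label v := by
      intro v
      induction v with
      | nil => exact fun _ => lab.symm
      | cons i u ih =>
        intro hv
        have hu := hD.2 u i hv
        rw [detLabel_cons ((ih hu).trans (hT u hu)) i, h u hu, hR u hu i]
    intro v hv i
    change detLabel S ω (i :: v) = _
    rw [detLabel_cons ((h0 v hv).trans (hT v hv)) i, h v hv, hR v hv i]

theorem detGrow_preimage_cyl {S : DetType A B f Xf} {t : (detBP A B f Xf).Tree S}
    {D : Finset (List ℕ)} (hD : t.IsPrefix D)
    (T : List ℕ → DetType A B f Xf) (R : List ℕ → List (DetType A B f Xf))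
    (hT : ∀ v ∈ D, t.label v = some (T v))
    (hR : ∀ v ∈ D, ∀ i, t.label (i :: v) = (R v)[i]?) :
    detGrow S ⁻¹' t.cyl D = Set.pi ((fun v => (v, (T v).type)) '' (D : Set (List ℕ)))
      (fun a : List ℕ × Γ => {r : B.Rule a.2 | detRule (T a.1) r.1 = R a.1}) := by
  ext ω
  simp only [Set.mem_preimage, detGrow_mem_cyl_iff hD T R hT hR, Set.mem_pi,
    Set.forall_mem_image, Finset.mem_coe, Set.mem_ofPred_eq]

theorem measurable_detGrow (S : DetType A B f Xf) :
    Measurable (detGrow S : B.Choice → (detBP A B f Xf).Tree S) := by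
  refine measurable_generateFrom ?_
  rintro _ ⟨t, D, hD, rfl⟩
  obtain ⟨T, R, hT, hR⟩ := t.exists_rules hD
  rw [detGrow_preimage_cyl hD T R hT hR]
  exact MeasurableSet.pi (D.countable_toSet.image _) fun _ _ => MeasurableSet.of_discrete

/-- The trees of `detBP` can be sampled by choosing rules of `B`. -/
theorem map_detGrow (S : DetType A B f Xf) :
    B.choiceMeasure.map (detGrow S) = (detBP A B f Xf).treeMeasure S := by
  classical
  have : IsProbabilityMeasure (B.choiceMeasure.map (detGrow S)) :=
    Measure.isProbabilityMeasure_map (measurable_detGrow S).aemeasurable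
  -- The preimage of a cylinder is a box with one coordinate per non-leaf address. Distinct
  -- addresses give distinct coordinates, so its measure is a product.
  refine BP.Tree.measure_ext (by simp) fun t D hD => ?_
  obtain ⟨T, R, hT, hR⟩ := t.exists_rules hD
  rw [BP.treeMeasure_cyl hD T R hT hR, Measure.map_apply (measurable_detGrow S)
    (BP.measurableSet_cyl hD), detGrow_preimage_cyl hD T R hT hR, ← Finset.coe_image,
    BP.choiceMeasure, Measure.infinitePi_pi _ (fun _ _ => MeasurableSet.of_discrete),
    Finset.prod_image (fun a _ b _ h => congrArg Prod.fst h)]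
  refine Finset.prod_congr rfl fun v _ => ?_
  exact rulePMF_detRule _ _

end SCCAutomaton

/-! ### Survival almost surely entails recurrence -/

section SCCAutomaton

variable {Γ Q : Type*} {A : NFA Γ Q} {B : BP Γ} {f : Q} {Xf : Γ}

open BP

theorem DetType.type_eq {S : DetType A B f Xf} {p : SCCState A B f Xf} (hp : some p ∈ S.1) :
    S.type = p.1.2 := by
  obtain ⟨q, hq, hq'⟩ := S.exists_type.choose_spec _ hp
  cases hq
  exact hq'.symm

/-- The fresh initial state cannot be reached by a nonempty word, so it belongs to no element of
`Γ'` and only product transitions matter. -/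
theorem DetType.mem_next_iff {S : DetType A B f Xf} {q : SCCState A B f Xf} {X : Γ} :
    some q ∈ (S.next X).1 ↔ ∃ p : SCCState A B f Xf, some p ∈ S.1 ∧
      q.1 ∈ (prodAut A B).step p.1 X := by
  refine NFA.mem_stepSet.trans ⟨?_, ?_⟩
  · rintro ⟨s, hs, hq⟩
    obtain ⟨X', hX'⟩ := S.exists_type
    obtain ⟨p, rfl, -⟩ := hX' s hs
    obtain ⟨r, hr, hr'⟩ := hq
    cases hr
    exact ⟨p, hs, hr'⟩
  · rintro ⟨p, hp, hq⟩
    exact ⟨some p, hp, q, rfl, hq⟩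

theorem DetType.exists_mem {S : DetType A B f Xf} (hS : S.1 ≠ ∅) :
    ∃ p : SCCState A B f Xf, some p ∈ S.1 := by
  obtain ⟨s, hs⟩ := Set.nonempty_iff_ne_empty.2 hS
  obtain ⟨X, hX⟩ := S.exists_type
  obtain ⟨p, rfl, -⟩ := hX s hs
  exact ⟨p, hs⟩

theorem DetType.ne_empty_of_next {S : DetType A B f Xf} {X : Γ} (h : (S.next X).1 ≠ ∅) :
    S.1 ≠ ∅ := by
  obtain ⟨q, hq⟩ := exists_mem h
  obtain ⟨p, hp, -⟩ := mem_next_iff.1 hq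
  exact Set.nonempty_iff_ne_empty.1 ⟨_, hp⟩

theorem DetType.type_next {S : DetType A B f Xf} {X : Γ} (h : (S.next X).1 ≠ ∅) :
    (S.next X).type = X := by
  obtain ⟨q, hq⟩ := exists_mem h
  obtain ⟨p, -, hp⟩ := mem_next_iff.1 hq
  rw [type_eq hq]
  exact hp.2.2

theorem DetType.mem_base_iff {q : SCCState A B f Xf} :
    some q ∈ (DetType.base A B f Xf).1 ↔ q = SCCState.base A B f Xf :=
  Option.some_inj

theorem detLabel_shiftChoice {S T : DetType A B f Xf} {ω : B.Choice} {v : List ℕ}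
    (h : detLabel S ω v = some T) (u : List ℕ) :
    detLabel T (shiftChoice v ω) u = detLabel S ω (u ++ v) := by
  induction u with
  | nil => exact h.symm
  | cons i u ih =>
    rw [List.cons_append, detLabel, detLabel, ih]
    rfl

/-- The label is determined by the choices at the proper ancestors, which have depth less than `n`.
-/
theorem measurableSet_detLabel [Finite Γ] [Finite Q] (S T : DetType A B f Xf) {v : List ℕ}
    {n : ℕ} (hv : v.length ≤ n) :
    MeasurableSet[choicesBelow B n] {ω | detLabel S ω v = some T} := by
  induction v generalizing T with
  | nil => exact @MeasurableSet.const _ (choicesBelow B n) (some S = some T)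
  | cons i v ih =>
    have hv' : v.length < n := hv
    have : {ω | detLabel S ω (i :: v) = some T} = ⋃ S' : DetType A B f Xf,
        {ω | detLabel S ω v = some S'} ∩
          {ω | ω (v, S'.type) ∈ {r : B.Rule S'.type | (detRule S' r.1)[i]? = some T}} := by
      ext ω
      simp only [Set.mem_ofPred_eq, Set.mem_iUnion, Set.mem_inter_iff]
      exact ⟨detLabel_cons_eq_some, fun ⟨S', h, h'⟩ => (detLabel_cons h i).trans h'⟩
    rw [this]
    exact MeasurableSet.iUnion fun S' => (ih S' hv'.le).inter
      (measurableSet_choicesBelow (a := (v, S'.type)) hv' _)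

/-- Some node of depth `n` has a nonempty label. -/
def aliveAt (S : DetType A B f Xf) (n : ℕ) : Set B.Choice :=
  {ω | ∃ v : List ℕ, v.length = n ∧ ∃ T : DetType A B f Xf, T.1 ≠ ∅ ∧ detLabel S ω v = some T}

/-- There are nodes with nonempty labels at all depths. -/
def survival (S : DetType A B f Xf) : Set B.Choice := ⋂ n, aliveAt S n

/-- The state `(f, X_f)` is reached at some node below the root, and there is survival from
this state on. -/
def recurrence (S : DetType A B f Xf) : Set B.Choice :=
  {ω | ∃ u : List ℕ, u ≠ [] ∧ ∃ T : DetType A B f Xf, some (SCCState.base A B f Xf) ∈ T.1 ∧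
    detLabel S ω u = some T ∧ shiftChoice u ω ∈ survival (DetType.base A B f Xf)}

theorem aliveAt_eq_iUnion (S : DetType A B f Xf) (n : ℕ) : aliveAt S n =
    ⋃ k : {v : List ℕ // v.length = n} × {T : DetType A B f Xf // T.1 ≠ ∅},
      {ω | detLabel S ω k.1.1 = some k.2.1} := by
  ext ω
  simp only [aliveAt, Set.mem_ofPred_eq, Set.mem_iUnion]
  exact ⟨fun ⟨v, hv, T, hT, h⟩ => ⟨⟨⟨v, hv⟩, ⟨T, hT⟩⟩, h⟩,
    fun ⟨k, h⟩ => ⟨k.1.1, k.1.2, k.2.1, k.2.2, h⟩⟩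

theorem measurableSet_survival [Finite Γ] [Finite Q] (S : DetType A B f Xf) :
    MeasurableSet (survival S) := by
  refine MeasurableSet.iInter fun n => ?_
  rw [aliveAt_eq_iUnion]
  exact MeasurableSet.iUnion fun k =>
    choicesBelow_le n _ (measurableSet_detLabel S k.2.1 k.1.2.le)

theorem measurableSet_recurrence [Finite Γ] [Finite Q] (S : DetType A B f Xf) :
    MeasurableSet (recurrence S) := by
  have : recurrence S = ⋃ (u : List ℕ) (_ : u ≠ []) (T : DetType A B f Xf)
      (_ : some (SCCState.base A B f Xf) ∈ T.1), {ω | detLabel S ω u = some T} ∩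
        shiftChoice u ⁻¹' survival (DetType.base A B f Xf) := by
    ext ω
    simp only [recurrence, Set.mem_ofPred_eq, Set.mem_iUnion, exists_prop, Set.mem_inter_iff,
      Set.mem_preimage]
  rw [this]
  exact MeasurableSet.iUnion fun u => MeasurableSet.iUnion fun _ => MeasurableSet.iUnion fun T =>
    MeasurableSet.iUnion fun _ => (choicesBelow_le u.length _
      (measurableSet_detLabel S T le_rfl)).inter
        (measurable_shiftChoice u (measurableSet_survival _))

theorem recurrence_of_shiftChoice {S T : DetType A B f Xf} {ω : B.Choice} {v : List ℕ}
    (h : detLabel S ω v = some T) (hω : shiftChoice v ω ∈ recurrence T) :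
    ω ∈ recurrence S := by
  obtain ⟨u, hu, T', hT', hl, hs⟩ := hω
  refine ⟨u ++ v, by simp [hu], T', hT', ?_, ?_⟩
  · rw [← detLabel_shiftChoice h, hl]
  · rwa [← shiftChoice_shiftChoice]

/-- If an automaton step is possible at the root, then every event of positive probability
happens with positive probability after that step. -/
theorem exists_step_pos [Finite Γ] [Finite Q] {S : DetType A B f Xf} {p : SCCState A B f Xf}
    {X : Γ} {q : Q × Γ} (hp : some p ∈ S.1) (hq : q ∈ (prodAut A B).step p.1 X)
    {G : Set B.Choice} (hG : MeasurableSet G) (hpos : 0 < B.choiceMeasure G) :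
    ∃ i : ℕ, 0 < B.choiceMeasure ({ω | detLabel S ω [i] = some (S.next X)} ∩
      shiftChoice [i] ⁻¹' G) := by
  obtain ⟨⟨u, w, hr⟩, -, -⟩ := hq
  rw [← DetType.type_eq hp] at hr
  have hS : S.1 ≠ ∅ := Set.nonempty_iff_ne_empty.1 ⟨_, hp⟩
  let r : B.Rule S.type := ⟨u ++ X :: w, Finsupp.mem_support_iff.2 hr⟩
  let R : Set B.Choice := {ω | ω ([], S.type) ∈ ({r} : Set (B.Rule S.type))}
  have hR : MeasurableSet[choicesBelow B 1] R :=
    measurableSet_choicesBelow (a := ([], S.type)) Nat.one_pos _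
  have hRpos : 0 < B.choiceMeasure R := by
    have h1 : B.choiceMeasure R = (B.rulePMF S.type).toMeasure {r} := by
      have := (measurePreserving_eval_infinitePi
        (fun a : List ℕ × Γ => (B.rulePMF a.2).toMeasure) ([], S.type)).measure_preimage
          (s := ({r} : Set (B.Rule S.type))) MeasurableSet.of_discrete.nullMeasurableSet
      exact this
    rw [h1, PMF.toMeasure_apply_singleton _ _ MeasurableSet.of_discrete]
    refine ENNReal.ofReal_pos.2 ?_
    exact_mod_cast lt_of_le_of_ne (B.prob_nonneg _ _) (Ne.symm hr)
  -- The child index is the position of `X` in the rule `u ++ X :: w`. The event `R` concerns the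
  -- root only, hence is independent of the subtree below.
  refine ⟨u.length, lt_of_lt_of_le ?_ (measure_mono (Set.inter_subset_inter_left _
    (?_ : R ⊆ _)))⟩
  · rw [choiceMeasure_inter_shift hR hG (by simp)]
    exact ENNReal.mul_pos hRpos.ne' hpos.ne'
  · intro ω hω
    have hω' : ω ([], S.type) = r := hω
    change detLabel S ω [u.length] = some (S.next X)
    rw [detLabel_cons (S' := S) rfl, hω', detRule_of_ne hS]
    simp [r]

/-- Induction along a path to `(f, X_f)`: its last edge is followed by survival, each earlier edge
by recurrence. The cycle keeps the path nontrivial even from `(f, X_f)` itself, as `recurrence`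
demands a node below the root. -/
theorem recurrence_pos [Finite Γ] [Finite Q]
    (hcycle : Relation.TransGen (prodAut A B).Edge (f, Xf) (f, Xf))
    (hpos : 0 < B.choiceMeasure (survival (DetType.base A B f Xf)))
    {S : DetType A B f Xf} (hS : S.1 ≠ ∅) : 0 < B.choiceMeasure (recurrence S) := by
  obtain ⟨⟨p, hfp, hpf⟩, hp⟩ := DetType.exists_mem hS
  have key : ∀ p : Q × Γ, Relation.TransGen (prodAut A B).Edge p (f, Xf) →
      ∀ (hfp : Relation.ReflTransGen (prodAut A B).Edge (f, Xf) p)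
        (hpf : Relation.ReflTransGen (prodAut A B).Edge p (f, Xf)) (S : DetType A B f Xf),
        some (⟨p, hfp, hpf⟩ : SCCState A B f Xf) ∈ S.1 →
        0 < B.choiceMeasure (recurrence S) := by
    intro p h
    induction h using Relation.TransGen.head_induction_on with
    | single h =>
      intro hfp hpf S hS
      obtain ⟨X, hX⟩ := h
      obtain ⟨i, hi⟩ := exists_step_pos hS hX (measurableSet_survival _) hpos
      refine hi.trans_le (measure_mono fun ω hω => ⟨[i], by simp, _, ?_, hω.1, hω.2⟩)
      exact DetType.mem_next_iff.2 ⟨_, hS, hX⟩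
    | head h h' ih =>
      intro hfp hpf S hS
      have hfc := hfp.tail h
      obtain ⟨X, hX⟩ := h
      obtain ⟨i, hi⟩ := exists_step_pos hS hX (measurableSet_recurrence _)
        (ih hfc h'.to_reflTransGen (S.next X) (DetType.mem_next_iff.2 ⟨_, hS, hX⟩))
      exact hi.trans_le (measure_mono fun ω hω => recurrence_of_shiftChoice hω.1 hω.2)
  exact key p (Relation.TransGen.trans_right hpf hcycle) hfp hpf S hp

/-- Alive nodes of depth `n` make recurrence likely, whatever happens above depth `n`. -/
theorem mul_le_measure_inter_recurrence [Finite Γ] [Finite Q] {ε : ENNReal}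
    (hε : ∀ T : DetType A B f Xf, T.1 ≠ ∅ → ε ≤ B.choiceMeasure (recurrence T))
    {S : DetType A B f Xf} {n : ℕ} {C : Set B.Choice} (hC : MeasurableSet[choicesBelow B n] C)
    (hCn : C ⊆ aliveAt S n) :
    ε * B.choiceMeasure C ≤ B.choiceMeasure (C ∩ recurrence S) := by
  have hne : Nonempty ({v : List ℕ // v.length = n} × {T : DetType A B f Xf // T.1 ≠ ∅}) :=
    ⟨⟨List.replicate n 0, by simp⟩, DetType.base A B f Xf, Set.singleton_ne_empty _⟩
  obtain ⟨g, hg⟩ := exists_surjective_nat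
    ({v : List ℕ // v.length = n} × {T : DetType A B f Xf // T.1 ≠ ∅})
  -- `disjointed N` splits `C` by the first alive pair of node and label in the enumeration `g`.
  -- Each piece is determined above depth `n`, hence independent of the subtree at the selected
  -- node.
  let N : ℕ → Set B.Choice := fun m => C ∩ {ω | detLabel S ω (g m).1.1 = some (g m).2.1}
  have hN : ∀ m, MeasurableSet[choicesBelow B n] (N m) := fun m =>
    hC.inter (measurableSet_detLabel S _ (g m).1.2.le)
  have hdm : ∀ m, MeasurableSet[choicesBelow B n] (disjointed N m) := fun m =>
    MeasurableSet.disjointed (mα := choicesBelow B n) hN m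
  have hdm' : ∀ m, MeasurableSet (disjointed N m) := fun m => choicesBelow_le n _ (hdm m)
  have hU : C = ⋃ m, disjointed N m := by
    rw [iUnion_disjointed]
    refine Set.Subset.antisymm (fun ω hω => ?_) (Set.iUnion_subset fun m => Set.inter_subset_left)
    have := hCn hω
    rw [aliveAt_eq_iUnion] at this
    obtain ⟨k, hk⟩ := Set.mem_iUnion.1 this
    obtain ⟨m, rfl⟩ := hg k
    exact Set.mem_iUnion.2 ⟨m, hω, hk⟩
  have hR := measurableSet_recurrence S
  have hdisj := disjoint_disjointed N
  rw [hU, Set.iUnion_inter, measure_iUnion hdisj hdm', measure_iUnion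
    (fun i j hij => (hdisj hij).mono Set.inter_subset_left Set.inter_subset_left)
    (fun m => (hdm' m).inter hR), ← ENNReal.tsum_mul_left]
  refine ENNReal.tsum_le_tsum fun m => ?_
  calc ε * B.choiceMeasure (disjointed N m)
      ≤ B.choiceMeasure (disjointed N m) * B.choiceMeasure (recurrence (g m).2.1) := by
        rw [mul_comm]
        gcongr
        exact hε _ (g m).2.2
    _ = B.choiceMeasure (disjointed N m ∩ shiftChoice (g m).1.1 ⁻¹' recurrence (g m).2.1) :=
        (choiceMeasure_inter_shift (hdm m) (measurableSet_recurrence _) (g m).1.2.ge).symm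
    _ ≤ B.choiceMeasure (disjointed N m ∩ recurrence S) := measure_mono fun ω hω =>
        ⟨hω.1, recurrence_of_shiftChoice (disjointed_subset N m hω.1).2 hω.2⟩

/-- A zero-one argument: an event of survival without recurrence is approximated by one determined
by finitely many levels; yet, as long as some node is alive, recurrence still has conditional
probability at least `ε`. -/
theorem measure_survival_diff_recurrence [Finite Γ] [Finite Q]
    (hcycle : Relation.TransGen (prodAut A B).Edge (f, Xf) (f, Xf))
    (hpos : 0 < B.choiceMeasure (survival (DetType.base A B f Xf))) (S : DetType A B f Xf) :
    B.choiceMeasure (survival S \ recurrence S) = 0 := by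
  classical
  obtain ⟨ε, hε0, hε⟩ : ∃ ε : ENNReal, 0 < ε ∧ ∀ T : DetType A B f Xf, T.1 ≠ ∅ →
      ε ≤ B.choiceMeasure (recurrence T) := by
    have : Nonempty (DetType A B f Xf) := ⟨S⟩
    -- The value 1 for the empty state only keeps the minimum positive.
    obtain ⟨T₀, hT₀⟩ := Finite.exists_min fun T : DetType A B f Xf =>
      if T.1 = ∅ then 1 else B.choiceMeasure (recurrence T)
    refine ⟨_, ?_, fun T hT => (hT₀ T).trans_eq (if_neg hT)⟩
    split_ifs with h
    · exact one_pos
    · exact recurrence_pos hcycle hpos h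
  have hε1 : ε ≤ 1 := (hε (DetType.base A B f Xf) (Set.singleton_ne_empty _)).trans prob_le_one
  have hεt : ε ≠ ⊤ := ne_top_of_le_ne_top ENNReal.one_ne_top hε1
  have hδ0 : 0 < ε.toReal := ENNReal.toReal_pos hε0.ne' hεt
  have hδ1 : ε.toReal ≤ 1 := ENNReal.toReal_le_of_le_ofReal zero_le_one (by simpa using hε1)
  set D := survival S \ recurrence S with hD
  by_contra hne
  have hd : 0 < B.choiceMeasure.real D := ENNReal.toReal_pos hne (measure_ne_top _ _)
  -- With `δ` the measure of the symmetric difference, the bounds below give `ε (P D - δ) ≤ δ`, so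
  -- `ε P D ≤ 2 δ` since `ε ≤ 1`; the tolerance `ε P D / 2` contradicts this.
  obtain ⟨n, C, hC, hCD⟩ := exists_choicesBelow_approx
    ((measurableSet_survival S).diff (measurableSet_recurrence S))
    (ε := ε.toReal * B.choiceMeasure.real D / 2) (by positivity)
  rw [← hD] at hCD
  have hA : MeasurableSet[choicesBelow B n] (C ∩ aliveAt S n) := by
    refine hC.inter ?_
    rw [aliveAt_eq_iUnion]
    exact MeasurableSet.iUnion fun k => measurableSet_detLabel S k.2.1 k.1.2.le
  have h1 : ε.toReal * B.choiceMeasure.real (C ∩ aliveAt S n) ≤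
      B.choiceMeasure.real (C ∩ aliveAt S n ∩ recurrence S) := by
    have := ENNReal.toReal_mono (measure_ne_top _ _)
      (mul_le_measure_inter_recurrence hε hA Set.inter_subset_right)
    rwa [ENNReal.toReal_mul] at this
  have h2 : B.choiceMeasure.real (C ∩ aliveAt S n ∩ recurrence S) ≤
      B.choiceMeasure.real (symmDiff D C) :=
    measureReal_mono fun ω hω => Or.inr ⟨hω.1.1, fun h => h.2 hω.2⟩
  have h3 : B.choiceMeasure.real D ≤
      B.choiceMeasure.real (C ∩ aliveAt S n) + B.choiceMeasure.real (symmDiff D C) := by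
    refine (measureReal_mono fun ω hω => ?_).trans (measureReal_union_le _ _)
    by_cases h : ω ∈ C
    · exact Or.inl ⟨h, Set.mem_iInter.1 hω.1 n⟩
    · exact Or.inr (Or.inl ⟨hω, h⟩)
  have h4 : 0 ≤ B.choiceMeasure.real (symmDiff D C) := measureReal_nonneg
  nlinarith [mul_le_mul_of_nonneg_left h3 hδ0.le, mul_le_mul_of_nonneg_right hδ1 h4]

end SCCAutomaton

/-! ### From recurrence to accepting runs, and back -/

/-- If every point of `G` has a nontrivial path to a point of `G`, then there is an infinite path
that visits `G` infinitely often. -/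
theorem exists_path_frequently_mem {α : Type*} {R : α → α → Prop} {G : Set α} {a : α} (ha : a ∈ G)
    (hG : ∀ c ∈ G, ∃ c' ∈ G, Relation.TransGen R c c') :
    ∃ s : ℕ → α, s 0 = a ∧ (∀ n, R (s n) (s (n + 1))) ∧ ∃ᶠ n in atTop, s n ∈ G := by
  classical
  let Near : ℕ → α → Prop := fun k c =>
    Nat.rec (motive := fun _ => α → Prop) (· ∈ G) (fun _ P c => ∃ d, R c d ∧ P d) k c
  have near : ∀ {c d}, Relation.ReflTransGen R c d → d ∈ G → ∃ k, Near k c := by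
    intro c d h hd
    induction h using Relation.ReflTransGen.head_induction_on with
    | refl => exact ⟨0, hd⟩
    | head h _ ih =>
      obtain ⟨k, hk⟩ := ih
      exact ⟨k + 1, _, h, hk⟩
  let Z := {c // ∃ k, Near k c}
  -- Outside `G` a step decreases the distance to `G`; inside `G` it is the first step of a
  -- nontrivial path back to `G`.
  have step : ∀ c : Z, ∃ d : Z, R c.1 d.1 ∧ (c.1 ∉ G → Nat.find d.2 < Nat.find c.2) := by
    rintro ⟨c, hc⟩
    by_cases hcG : c ∈ G
    · obtain ⟨c', hc', h⟩ := hG c hcG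
      obtain ⟨d, hd, hd'⟩ := Relation.TransGen.head'_iff.1 h
      exact ⟨⟨d, near hd' hc'⟩, hd, fun h => absurd hcG h⟩
    · have hk := Nat.find_spec hc
      rcases h : Nat.find hc with _ | k
      · rw [h] at hk
        exact absurd hk hcG
      · rw [h] at hk
        obtain ⟨d, hd, hd'⟩ := hk
        exact ⟨⟨d, k, hd'⟩, hd, fun _ => by
          exact Nat.lt_succ_of_le (Nat.find_min' _ hd')⟩
  choose nx hR hlt using step
  let s : ℕ → Z := fun n => nx^[n] ⟨a, 0, ha⟩
  have hs : ∀ n, s (n + 1) = nx (s n) := fun n => Function.iterate_succ_apply' _ _ _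
  refine ⟨fun n => (s n).1, rfl, fun n => ?_, ?_⟩
  · simp only [hs]
    exact hR _
  rw [frequently_atTop]
  have : ∀ k n, Nat.find (s n).2 ≤ k → ∃ m ≥ n, (s m).1 ∈ G := by
    intro k
    induction k with
    | zero =>
      intro n hn
      by_contra! h
      exact absurd (hlt _ (h n le_rfl)) (by omega)
    | succ k ih =>
      intro n hn
      by_cases h : (s n).1 ∈ G
      · exact ⟨n, le_rfl, h⟩
      · obtain ⟨m, hm, hmG⟩ := ih (n + 1) (by
          have := hlt _ h
          simp only [hs]
          omega)
        exact ⟨m, by omega, hmG⟩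
  exact fun n => this _ n le_rfl

section SCCAutomaton

variable {Γ Q : Type*} {A : NFA Γ Q} {B : BP Γ} {f : Q} {Xf : Γ}

open BP

/-- One step of a run of the automaton down a branch of the tree grown by `ω`. -/
def RunStep (A : NFA Γ Q) (f : Q) (Xf : Γ) (ω : B.Choice)
    (c d : List ℕ × SCCState A B f Xf) : Prop :=
  ∃ i, d.1 = i :: c.1 ∧ growLabel Xf ω d.1 = some d.2.1.2 ∧
    d.2.1 ∈ (prodAut A B).step c.2.1 d.2.1.2

/-- Each member of a subset state has a predecessor in the state before, so a run can be traced back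
to the base. Its types agree with the labels grown by `ω`, so both trees consult the same choices.
-/
theorem exists_run_of_detLabel {ω : B.Choice} {v : List ℕ} (hv : growLabel Xf ω v = some Xf)
    (u : List ℕ) {T : DetType A B f Xf}
    (hT : detLabel (DetType.base A B f Xf) (shiftChoice v ω) u = some T)
    {q : SCCState A B f Xf} (hq : some q ∈ T.1) :
    growLabel Xf ω (u ++ v) = some q.1.2 ∧
      Relation.ReflTransGen (RunStep A f Xf ω) (v, SCCState.base A B f Xf) (u ++ v, q) := by
  induction u generalizing T q with
  | nil =>
    cases hT
    rw [DetType.mem_base_iff] at hq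
    subst hq
    exact ⟨hv, Relation.ReflTransGen.refl⟩
  | cons i u ih =>
    obtain ⟨S, hS, hST⟩ := detLabel_cons_eq_some hT
    have hne : S.1 ≠ ∅ := by
      intro h
      rw [detRule, if_pos h] at hST
      have := List.mem_singleton.1 (List.mem_of_getElem? hST)
      subst this
      rw [h] at hq
      exact hq
    rw [detRule_of_ne hne, List.getElem?_map, Option.map_eq_some_iff] at hST
    obtain ⟨X, hX, rfl⟩ := hST
    obtain ⟨p, hp, hpq⟩ := DetType.mem_next_iff.1 hq
    obtain ⟨hl, hr⟩ := ih hS hp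
    have hqX : q.1.2 = X := hpq.2.2
    subst hqX
    have hlab : growLabel Xf ω (i :: (u ++ v)) = some q.1.2 := by
      rw [← DetType.type_eq hp] at hl
      rw [growLabel, hl]
      exact hX
    exact ⟨hlab, hr.tail ⟨i, rfl, hlab, hpq⟩⟩

/-- Some branch of `t` is accepted by `A[f, X_f]`. -/
def BP.Tree.HasBuchiBranch (A : NFA Γ Q) (f : Q) (t : B.Tree Xf) : Prop :=
  ∃ (v : ℕ → List ℕ) (x : ℕ → Γ), t.IsBranch v ∧
    (∀ n, t.label (v n) = some (x n)) ∧ (sccAut A B f Xf).BuchiAccepts x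

/-- `recurrence` restarts from `{(f, X_f)}` alone, not from the whole subset state. Hence every run
traced back from the next return ends at the previous one, and the pieces fit together. -/
theorem hasBuchiBranch_grow {ω : B.Choice}
    (h : ∀ v, shiftChoice v ω ∈ survival (DetType.base A B f Xf) →
      shiftChoice v ω ∈ recurrence (DetType.base A B f Xf))
    (h0 : ω ∈ survival (DetType.base A B f Xf)) : (grow Xf ω).HasBuchiBranch A f := by
  let G : Set (List ℕ × SCCState A B f Xf) := {c | c.2 = SCCState.base A B f Xf ∧
    growLabel Xf ω c.1 = some Xf ∧ shiftChoice c.1 ω ∈ survival (DetType.base A B f Xf)}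
  have hshift : shiftChoice [] ω = ω := by
    funext a
    change ω (a.1 ++ [], a.2) = ω (a.1, a.2)
    rw [List.append_nil]
  have h0G : ([], SCCState.base A B f Xf) ∈ G := ⟨rfl, rfl, by rwa [hshift]⟩
  obtain ⟨s, hs0, hs, hG⟩ := exists_path_frequently_mem (R := RunStep A f Xf ω) h0G (by
    rintro ⟨v, q⟩ ⟨hq, hl, hv⟩
    simp only at hq
    subst hq
    obtain ⟨u, hu, T, hT, hlab, hsurv⟩ := h v hv
    obtain ⟨hl', hr⟩ := exists_run_of_detLabel hl u hlab hT
    refine ⟨_, ⟨rfl, hl', ?_⟩, (Relation.reflTransGen_iff_eq_or_transGen.1 hr).resolve_left ?_⟩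
    · rwa [← shiftChoice_shiftChoice]
    · intro heq
      have := congrArg (fun c => c.1.length) heq
      simp only [List.length_append] at this
      exact hu (List.length_eq_zero_iff.1 (by omega)))
  have hlab : ∀ n, growLabel Xf ω (s n).1 = some (s n).2.1.2 := by
    intro n
    cases n with
    | zero => rw [hs0]; rfl
    | succ n => obtain ⟨i, -, hl, -⟩ := hs n; exact hl
  -- The run is delayed by one index: it starts in the fresh state and enters `(f, X_f)` on reading
  -- the type of the root.
  refine ⟨fun n => (s n).1, fun n => (s n).2.1.2, ⟨congrArg Prod.fst hs0, fun n => ⟨?_, ?_⟩⟩,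
    hlab, fun n => Nat.casesOn n none fun n => some (s n).2, Set.mem_singleton _, ?_, ?_⟩
  · change growLabel Xf ω (s n).1 ≠ none
    rw [hlab n]
    exact Option.some_ne_none _
  · obtain ⟨i, hi, -⟩ := hs n
    exact ⟨i, hi⟩
  · intro n
    cases n with
    | zero =>
      change (s 0).2.1.2 = Xf ∧ some (s 0).2 = _
      rw [hs0]
      exact ⟨rfl, rfl⟩
    | succ n =>
      obtain ⟨i, -, -, hst⟩ := hs n
      exact ⟨(s (n + 1)).2, rfl, hst⟩
  · rw [frequently_atTop] at hG ⊢
    intro n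
    obtain ⟨m, hm, hmG⟩ := hG n
    exact ⟨m + 1, by omega, congrArg some hmG.1⟩

/-- `S` is the state of the determinized automaton at the node `v` of `t`. -/
def BP.Tree.IsDetState (t : B.Tree Xf) : List ℕ → DetType A B f Xf → Prop
  | [], S => S = DetType.base A B f Xf
  | i :: v, S => ∃ (S' : DetType A B f Xf) (Y : Γ), t.IsDetState v S' ∧
      t.label (i :: v) = some Y ∧ S'.next Y = S

/-- The trees on which the determinized automaton survives to all depths. -/
def detSurvivalTrees (A : NFA Γ Q) (B : BP Γ) (f : Q) (Xf : Γ) : Set (B.Tree Xf) :=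
  {t | ∀ n, ∃ v : List ℕ, v.length = n ∧ ∃ S : DetType A B f Xf, S.1 ≠ ∅ ∧ t.IsDetState v S}

theorem measurableSet_isDetState [Finite Γ] [Finite Q] (v : List ℕ) (S : DetType A B f Xf) :
    MeasurableSet {t : B.Tree Xf | t.IsDetState v S} := by
  induction v generalizing S with
  | nil => exact MeasurableSet.const (S = DetType.base A B f Xf)
  | cons i v ih =>
    have : {t : B.Tree Xf | t.IsDetState (i :: v) S} = ⋃ (S' : DetType A B f Xf) (Y : Γ)
        (_ : S'.next Y = S), {t | t.IsDetState v S'} ∩ {t | t.label (i :: v) = some Y} := by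
      ext t
      simp only [Tree.IsDetState, Set.mem_ofPred_eq, Set.mem_iUnion, Set.mem_inter_iff, exists_prop]
      exact exists₂_congr fun _ _ => by tauto
    rw [this]
    exact MeasurableSet.iUnion fun S' => MeasurableSet.iUnion fun Y => MeasurableSet.iUnion fun _ =>
      (ih S').inter (measurableSet_label_eq_some _ _)

theorem measurableSet_detSurvivalTrees [Finite Γ] [Finite Q] :
    MeasurableSet (detSurvivalTrees A B f Xf) := by
  have : detSurvivalTrees A B f Xf = ⋂ n, ⋃ (v : List ℕ) (_ : v.length = n)
      (S : DetType A B f Xf) (_ : S.1 ≠ ∅), {t | t.IsDetState v S} := by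
    ext t
    simp only [detSurvivalTrees, Set.mem_ofPred_eq, Set.mem_iInter, Set.mem_iUnion, exists_prop]
  rw [this]
  exact MeasurableSet.iInter fun n => MeasurableSet.iUnion fun v => MeasurableSet.iUnion fun _ =>
    MeasurableSet.iUnion fun S => MeasurableSet.iUnion fun _ => measurableSet_isDetState v S

theorem BP.Tree.HasBuchiBranch.mem_detSurvivalTrees {t : B.Tree Xf} (h : t.HasBuchiBranch A f) :
    t ∈ detSurvivalTrees A B f Xf := by
  obtain ⟨v, x, ⟨hv0, hv⟩, hx, r, hr0, hr, -⟩ := h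
  have key : ∀ n, (v n).length = n ∧ ∃ S : DetType A B f Xf, r (n + 1) ∈ S.1 ∧
      t.IsDetState (v n) S := by
    intro n
    induction n with
    | zero =>
      have h1 := hr 0
      rw [Set.mem_singleton_iff.1 hr0] at h1
      refine ⟨by rw [hv0]; rfl, DetType.base A B f Xf, h1.2, ?_⟩
      rw [hv0]
      rfl
    | succ n ih =>
      obtain ⟨hl, S, hS, hSt⟩ := ih
      obtain ⟨i, hi⟩ := (hv n).2
      refine ⟨by rw [hi, List.length_cons, hl], S.next (x (n + 1)),
        NFA.mem_stepSet.2 ⟨_, hS, hr (n + 1)⟩, ?_⟩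
      have := hx (n + 1)
      rw [hi] at this ⊢
      exact ⟨S, _, hSt, this, rfl⟩
  intro n
  obtain ⟨hl, S, hS, hSt⟩ := key n
  exact ⟨v n, hl, S, Set.nonempty_iff_ne_empty.1 ⟨_, hS⟩, hSt⟩

/-- Nonemptiness is essential: below `∅` the tree of `detBP` has single children and no longer
follows the tree of `B`. -/
theorem detLabel_of_isDetState {ω : B.Choice} {v : List ℕ} {S : DetType A B f Xf} (hS : S.1 ≠ ∅)
    (h : (grow Xf ω).IsDetState v S) : detLabel (DetType.base A B f Xf) ω v = some S ∧
      growLabel Xf ω v = some S.type := by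
  induction v generalizing S with
  | nil =>
    cases h
    refine ⟨rfl, ?_⟩
    rw [DetType.type_eq (DetType.mem_base_iff.2 rfl)]
    rfl
  | cons i v ih =>
    obtain ⟨S', Y, hS', hY, rfl⟩ := h
    have hne := DetType.ne_empty_of_next hS
    obtain ⟨h1, h2⟩ := ih hne hS'
    change growLabel Xf ω (i :: v) = some Y at hY
    refine ⟨?_, by rw [DetType.type_next hS, hY]⟩
    rw [growLabel, h2] at hY
    rw [detLabel_cons h1, detRule_of_ne hne, List.getElem?_map]
    exact (congrArg _ hY).trans rfl

theorem grow_preimage_detSurvivalTrees_subset :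
    grow Xf ⁻¹' detSurvivalTrees A B f Xf ⊆ survival (DetType.base A B f Xf) := by
  intro ω hω
  refine Set.mem_iInter.2 fun n => ?_
  obtain ⟨v, hv, S, hS, h⟩ := hω n
  exact ⟨v, hv, S, hS, (detLabel_of_isDetState hS h).1⟩

/-- Measurability of the acceptance event is avoided: it lies in the measurable set
`detSurvivalTrees`, which bounds it from above, and `Measure.le_map_apply` bounds the measure of an
arbitrary set from below. -/
theorem pos_hasBuchiBranch_iff [Finite Γ] [Finite Q]
    (hcycle : Relation.TransGen (prodAut A B).Edge (f, Xf) (f, Xf)) :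
    0 < B.treeMeasure Xf {t | t.HasBuchiBranch A f} ↔
      0 < B.choiceMeasure (survival (DetType.base A B f Xf)) := by
  constructor
  · intro h
    refine h.trans_le ?_
    calc B.treeMeasure Xf {t | t.HasBuchiBranch A f}
        ≤ B.treeMeasure Xf (detSurvivalTrees A B f Xf) :=
          measure_mono fun t ht => ht.mem_detSurvivalTrees
      _ = B.choiceMeasure (grow Xf ⁻¹' detSurvivalTrees A B f Xf) :=
          Measure.map_apply (measurable_grow Xf) measurableSet_detSurvivalTrees
      _ ≤ _ := measure_mono grow_preimage_detSurvivalTrees_subset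
  · intro h
    refine h.trans_le (le_trans ?_
      (Measure.le_map_apply (measurable_grow Xf).aemeasurable _))
    -- There are countably many addresses and every shift preserves the measure, so one null set
    -- serves all nodes.
    have hae : ∀ᵐ ω ∂B.choiceMeasure, ∀ v, shiftChoice v ω ∈ survival (DetType.base A B f Xf) →
        shiftChoice v ω ∈ recurrence (DetType.base A B f Xf) := by
      refine ae_all_iff.2 fun v => (measurePreserving_shiftChoice v).quasiMeasurePreserving.ae
        (p := fun ω => ω ∈ survival (DetType.base A B f Xf) →
          ω ∈ recurrence (DetType.base A B f Xf)) ?_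
      rw [ae_iff]
      simp only [Classical.not_imp]
      exact measure_survival_diff_recurrence hcycle h _
    refine measure_mono_ae ?_
    filter_upwards [hae] with ω hω hs
    exact hasBuchiBranch_grow hω hs

/-! ### Branches avoiding `∅` and conclusion -/

theorem detBP_isRule_of_empty {S : DetType A B f Xf} (hS : S.1 = ∅) {w : List (DetType A B f Xf)}
    (h : (detBP A B f Xf).IsRule S w) : w = [S] := by
  classical
  have hp : (detBP A B f Xf).prob S = Finsupp.single [S] 1 := if_pos hS
  rw [IsRule, hp, Finsupp.single_apply] at h
  by_contra hw
  exact h (if_neg (Ne.symm hw))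

/-- König's lemma applies since `∅` produces only `∅`, which makes the nonempty nodes closed under
parents, and rules have finite length. The level-wise form is visibly measurable. -/
theorem exists_nonempty_branch_iff {S : DetType A B f Xf} (t : (detBP A B f Xf).Tree S) :
    (∃ v : ℕ → List ℕ, t.IsBranch v ∧ ∀ n T, t.label (v n) = some T → T.1 ≠ ∅) ↔
      ∀ n, ∃ v : List ℕ, v.length = n ∧ ∃ T : DetType A B f Xf, T.1 ≠ ∅ ∧
        t.label v = some T := by
  constructor
  · rintro ⟨v, ⟨hv0, hv⟩, hne⟩ n
    have hl : (v n).length = n := by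
      induction n with
      | zero => rw [hv0]; rfl
      | succ n ih =>
        obtain ⟨i, hi⟩ := (hv n).2
        rw [hi, List.length_cons, ih]
    obtain ⟨T, hT⟩ := Option.ne_none_iff_exists'.1 (hv n).1
    exact ⟨v n, hl, T, hne n T hT, hT⟩
  · intro h
    obtain ⟨v, hv0, hv⟩ := exists_branch_of_forall_level
      (N := {v | ∃ T : DetType A B f Xf, T.1 ≠ ∅ ∧ t.label v = some T})
      (by
        rintro v i ⟨T, hT, hl⟩
        rcases hv : t.label v with _ | U
        · have : t.label (i :: v) = none := t.2.2.1 v hv i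
          rw [hl] at this
          cases this
        · refine ⟨U, fun hU => hT ?_, hv⟩
          obtain ⟨w, hw, hw'⟩ := t.2.2.2 v U hv
          rw [detBP_isRule_of_empty hU hw] at hw'
          have := List.mem_of_getElem? ((hw' i).symm.trans hl)
          rw [List.mem_singleton.1 this, hU])
      (by
        intro v
        rcases hv : t.label v with _ | U
        · refine Set.finite_empty.subset ?_
          rintro i ⟨T, -, hl⟩
          have : t.label (i :: v) = none := t.2.2.1 v hv i
          rw [hl] at this
          cases this
        · obtain ⟨w, -, hw'⟩ := t.2.2.2 v U hv
          refine (Set.finite_lt_nat w.length).subset ?_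
          rintro i ⟨T, -, hl⟩
          exact (List.getElem?_eq_some_iff.1 ((hw' i).symm.trans hl)).1)
      (fun n => by
        obtain ⟨v, hv, hT⟩ := h n
        exact ⟨v, hT, hv⟩)
    refine ⟨v, ⟨hv0, fun n => ⟨?_, (hv n).2⟩⟩, fun n T hT => ?_⟩
    · obtain ⟨T, -, hl⟩ := (hv n).1
      rw [hl]
      exact Option.some_ne_none _
    · obtain ⟨T', hT', hl⟩ := (hv n).1
      rw [hT] at hl
      cases hl
      exact hT'

theorem treeMeasure_exists_nonempty_branch [Finite Γ] [Finite Q] (S : DetType A B f Xf) :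
    (detBP A B f Xf).treeMeasure S {t | ∃ v : ℕ → List ℕ, t.IsBranch v ∧
      ∀ n T, t.label (v n) = some T → T.1 ≠ ∅} = B.choiceMeasure (survival S) := by
  have hset : {t : (detBP A B f Xf).Tree S | ∃ v : ℕ → List ℕ, t.IsBranch v ∧
      ∀ n T, t.label (v n) = some T → T.1 ≠ ∅} = ⋂ n, ⋃ (v : List ℕ) (_ : v.length = n)
        (T : DetType A B f Xf) (_ : T.1 ≠ ∅), {t | t.label v = some T} := by
    ext t
    simp only [Set.mem_ofPred_eq, exists_nonempty_branch_iff, Set.mem_iInter, Set.mem_iUnion,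
      exists_prop]
  rw [hset, ← map_detGrow, Measure.map_apply (measurable_detGrow S)]
  · congr 1
    ext ω
    simp only [Set.mem_preimage, survival, aliveAt, Set.mem_iInter, Set.mem_iUnion,
      Set.mem_ofPred_eq, exists_prop]
    rfl
  · exact MeasurableSet.iInter fun n => MeasurableSet.iUnion fun v => MeasurableSet.iUnion fun _ =>
      MeasurableSet.iUnion fun T => MeasurableSet.iUnion fun _ => measurableSet_label_eq_some v T

end SCCAutomaton

theorem BP.treeMeasure_withStart {Γ : Type*} (B : BP Γ) (X Y : Γ) :
    (B.withStart Y).treeMeasure X = B.treeMeasure X := by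
  refine Tree.measure_ext (B := B.withStart Y)
    (measure_univ.trans (measure_univ (μ := B.treeMeasure X)).symm) fun t D hD => ?_
  obtain ⟨T, R, hT, hR⟩ := t.exists_rules hD
  exact (treeMeasure_cyl hD T R hT hR).trans
    (treeMeasure_cyl (B := B) (t := t) hD T R hT hR).symm

theorem mainTheorem6 {Γ Q : Type*} [Finite Γ] [Finite Q] (B : BP Γ) (A : NFA Γ Q)
    (f : Q) (hf : f ∈ A.accept) (Xf : Γ)
    (hcycle : Relation.TransGen (prodAut A B).Edge (f, Xf) (f, Xf)) :
    0 < (B.withStart Xf).P {t | ∃ (v : ℕ → List ℕ) (x : ℕ → Γ), t.IsBranch v ∧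
          (∀ n, t.label (v n) = some (x n)) ∧ (sccAut A B f Xf).BuchiAccepts x} ↔
      0 < (detBP A B f Xf).P {t | ∃ v : ℕ → List ℕ, t.IsBranch v ∧
          ∀ n S, t.label (v n) = some S → S.1 ≠ ∅} := by
  have h := pos_hasBuchiBranch_iff (A := A) hcycle
  rw [← treeMeasure_exists_nonempty_branch] at h
  rw [← B.treeMeasure_withStart Xf Xf] at h
  exact h
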